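/- Let $\mathcal G\rightrightarrows X$ be a locally compact Hausdorff étale topological groupoid (with continuous structure maps, range $r$ and source $s$) whose unit space $X$ is $\sigma$-compact. Let $Y$ be a locally compact Hausdorff space with a continuous right action of $\mathcal G$ whose momentum map $\pi:Y\to X$ is continuous, surjective, open and proper; write $Y_x=\pi^{-1}(x)$. Let $M$ be the set of Radon probability measures $\mu$ on $Y$ with $\operatorname{Supp}\mu\subset Y_x$ for some $x\in X$. This $x$ is unique and is denoted $\tilde\pi(\mu)$. Give $M$ the weak-$*$ topology, i.e. the coarsest topology for which $\mu\mapsto\int f\,d\mu$ is continuous for every $f\in C_0(Y)$, and the continuous right action of $\mathcal G$ with momentum map $\tilde\pi$ defined, for $\tilde\pi(\mu)=r(\gamma)$, by $$\int_Y f\,d(\mu\cdot\gamma)=\int_{Y_{r(\gamma)}}f(z\gamma)\,d\mu(z),\qquad f\in C_0(Y).$$ For a continuous right action of $\mathcal G$ on a space $Z$ with momentum map $p:Z\to X$, the transformation groupoid $Z\rtimes\mathcal G\rightrightarrows Z$ has arrow space $\{(z,\gamma)\in Z\times\mathcal G: p(z)=r(\gamma)\}$; the arrow $(z,\gamma)$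 has range $z$ and source $z\gamma$, and $(z,\gamma)(z\gamma,\eta)=(z,\gamma\eta)$, $(z,\gamma)^{-1}=(z\gamma,\gamma^{-1})$. A topological groupoid $\mathcal H$ is called amenable if there is a net $(\varphi_i)_{i\in I}$ of continuous compactly supported functions $\varphi_i:\mathcal H\to\mathbb C$ of positive type (that is, $\sum_{k,l=1}^n\overline{\lambda_k}\lambda_l\,\varphi_i(\gamma_k^{-1}\gamma_l)\ge 0$ for all $n$, all units $x$, all $\gamma_1,\dots,\gamma_n$ with range $x$ and all $\lambda_1,\dots,\lambda_n\in\mathbb C$) such that $\varphi_i\le 1$ on the unit space $\mathcal H^{(0)}$ for every $i$, and $\varphi_i\to 1$ uniformly on every compact subset of $\mathcal H$. Proposition. If the transformation groupoid $Y\rtimes\mathcal G$ is amenable, then the transformation groupoid $M\rtimes\mathcal G$ is amenable. -/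

import Mathlib

open scoped Topology ZeroAtInfty ComplexOrder

universe u v w

/-- A topological groupoid `G ⇉ X`: the arrow space is `G`, the unit space is `X`, the product
is defined on the composable pairs `{(γ, η) | s γ = r η}`, and all structure maps are
continuous. -/
structure TopGroupoid (G : Type u) (X : Type v) [TopologicalSpace G] [TopologicalSpace X] where
  s : G → X
  r : G → X
  unit : X → G
  inv : G → G
  mul : {p : G × G // s p.1 = r p.2} → G
  s_unit : ∀ x, s (unit x) = x
  r_unit : ∀ x, r (unit x) = x
  r_mul : ∀ p, r (mul p) = r p.1.1
  s_mul : ∀ p, s (mul p) = s p.1.2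
  s_inv : ∀ γ, s (inv γ) = r γ
  r_inv : ∀ γ, r (inv γ) = s γ
  mul_assoc : ∀ (γ η δ : G) (h₁ : s γ = r η) (h₂ : s η = r δ),
    mul ⟨(γ, mul ⟨(η, δ), h₂⟩), h₁.trans (r_mul ⟨(η, δ), h₂⟩).symm⟩ =
      mul ⟨(mul ⟨(γ, η), h₁⟩, δ), (s_mul ⟨(γ, η), h₁⟩).trans h₂⟩
  mul_unit : ∀ γ, mul ⟨(γ, unit (s γ)), (r_unit (s γ)).symm⟩ = γ
  unit_mul : ∀ γ, mul ⟨(unit (r γ), γ), s_unit (r γ)⟩ = γ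
  mul_inv : ∀ γ, mul ⟨(γ, inv γ), (r_inv γ).symm⟩ = unit (r γ)
  inv_mul : ∀ γ, mul ⟨(inv γ, γ), s_inv γ⟩ = unit (s γ)
  continuous_s : Continuous s
  continuous_r : Continuous r
  continuous_unit : Continuous unit
  continuous_inv : Continuous inv
  continuous_mul : Continuous mul

namespace TopGroupoid

variable {G : Type u} {X : Type v} [TopologicalSpace G] [TopologicalSpace X]

/-- A topological groupoid is étale if its range and source maps are local homeomorphisms. -/
structure IsEtale (𝒢 : TopGroupoid G X) : Prop where
  r_isLocalHomeomorph : IsLocalHomeomorph 𝒢.r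
  s_isLocalHomeomorph : IsLocalHomeomorph 𝒢.s

/-- `φ : G → ℂ` is of positive type: for all `x` and all `γ₁, …, γₙ` with range `x`, the matrix
`(φ (γᵢ⁻¹ γⱼ))` is positive semidefinite. In `0 ≤ z` for complex `z` it is understood that `z` is
real. -/
def IsPositiveType (𝒢 : TopGroupoid G X) (φ : G → ℂ) : Prop :=
  ∀ (n : ℕ) (x : X) (γ : Fin n → G) (hγ : ∀ i, 𝒢.r (γ i) = x) (c : Fin n → ℂ),
    0 ≤ ∑ i, ∑ j, (starRingEnd ℂ) (c i) * c j *
      φ (𝒢.mul ⟨(𝒢.inv (γ i), γ j), (𝒢.s_inv (γ i)).trans ((hγ i).trans (hγ j).symm)⟩)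

/-- Amenability of a topological groupoid: there is a net of continuous, compactly supported
functions of positive type, at most `1` on the units, that converges to `1` uniformly on compact
subsets of the arrow space. (Allowing index sets in other universes gives the same notion, since a
net can always be reindexed by the pairs of a compact set and a natural number.) -/
def IsAmenable (𝒢 : TopGroupoid G X) : Prop :=
  ∃ (I : Type u) (_ : Preorder I) (_ : IsDirectedOrder I) (_ : Nonempty I) (φ : I → G → ℂ),
    (∀ i, Continuous (φ i) ∧ HasCompactSupport (φ i) ∧ 𝒢.IsPositiveType (φ i) ∧
      ∀ x, φ i (𝒢.unit x) ≤ 1) ∧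
    ∀ K : Set G, IsCompact K → TendstoUniformlyOn φ (fun _ => 1) Filter.atTop K

theorem mul_congr (𝒢 : TopGroupoid G X) {γ γ' η η' : G} (h₁ : γ = γ') (h₂ : η = η')
    (h : 𝒢.s γ = 𝒢.r η) (h' : 𝒢.s γ' = 𝒢.r η') :
    𝒢.mul ⟨(γ, η), h⟩ = 𝒢.mul ⟨(γ', η'), h'⟩ := by
  subst h₁ h₂; rfl

theorem t2Space_unitSpace (𝒢 : TopGroupoid G X) [T2Space G] : T2Space X :=
  T2Space.of_injective_continuous
    (Function.LeftInverse.injective (g := 𝒢.r) 𝒢.r_unit) 𝒢.continuous_unit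

theorem IsEtale.locallyCompactSpace_unitSpace {𝒢 : TopGroupoid G X} (h : 𝒢.IsEtale)
    [LocallyCompactSpace G] : LocallyCompactSpace X :=
  IsOpenQuotientMap.locallyCompactSpace
    ⟨fun x => ⟨𝒢.unit x, 𝒢.r_unit x⟩, 𝒢.continuous_r, h.r_isLocalHomeomorph.isOpenMap⟩

/-- A continuous right action of a topological groupoid `G ⇉ X` on a space `Z`, with momentum map
`Z → X`; `z · γ` is defined when `momentum z = r γ`. -/
structure RightAction (𝒢 : TopGroupoid G X) (Z : Type w) [TopologicalSpace Z] where
  momentum : Z → X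
  act : {p : Z × G // momentum p.1 = 𝒢.r p.2} → Z
  momentum_act : ∀ p, momentum (act p) = 𝒢.s p.1.2
  act_unit : ∀ z, act ⟨(z, 𝒢.unit (momentum z)), (𝒢.r_unit (momentum z)).symm⟩ = z
  act_act : ∀ (z : Z) (γ η : G) (h₁ : momentum z = 𝒢.r γ) (h₂ : 𝒢.s γ = 𝒢.r η),
    act ⟨(act ⟨(z, γ), h₁⟩, η), (momentum_act ⟨(z, γ), h₁⟩).trans h₂⟩ =
      act ⟨(z, 𝒢.mul ⟨(γ, η), h₂⟩), h₁.trans (𝒢.r_mul ⟨(γ, η), h₂⟩).symm⟩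
  continuous_momentum : Continuous momentum
  continuous_act : Continuous act

namespace RightAction

variable {𝒢 : TopGroupoid G X} {Z : Type w} [TopologicalSpace Z] (A : 𝒢.RightAction Z)

theorem act_congr {z z' : Z} {γ γ' : G} (h₁ : z = z') (h₂ : γ = γ')
    (h : A.momentum z = 𝒢.r γ) (h' : A.momentum z' = 𝒢.r γ') :
    A.act ⟨(z, γ), h⟩ = A.act ⟨(z', γ'), h'⟩ := by
  subst h₁ h₂; rfl

/-- The arrow space `{(z, γ) ∈ Z × G | momentum z = r γ}` of the transformation groupoid. -/
abbrev Arrows : Type (max w u) := {p : Z × G // A.momentum p.1 = 𝒢.r p.2}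

/-- The transformation groupoid `Z ⋊ 𝒢 ⇉ Z`: the arrow `(z, γ)` goes from `z · γ` to `z`,
`(z, γ) (z · γ, η) = (z, γ η)` and `(z, γ)⁻¹ = (z · γ, γ⁻¹)`. -/
def transformationGroupoid : TopGroupoid A.Arrows Z where
  s p := A.act p
  r p := p.1.1
  unit z := ⟨(z, 𝒢.unit (A.momentum z)), (𝒢.r_unit (A.momentum z)).symm⟩
  inv p := ⟨(A.act p, 𝒢.inv p.1.2), (A.momentum_act p).trans (𝒢.r_inv p.1.2).symm⟩
  mul q :=
    have h : 𝒢.s q.1.1.1.2 = 𝒢.r q.1.2.1.2 :=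
      ((A.momentum_act q.1.1).symm.trans (congrArg A.momentum q.2)).trans q.1.2.2
    ⟨(q.1.1.1.1, 𝒢.mul ⟨(q.1.1.1.2, q.1.2.1.2), h⟩),
      q.1.1.2.trans (𝒢.r_mul ⟨(q.1.1.1.2, q.1.2.1.2), h⟩).symm⟩
  s_unit z := A.act_unit z
  r_unit _ := rfl
  r_mul _ := rfl
  s_mul := by
    rintro ⟨⟨⟨⟨z, γ⟩, h₁⟩, ⟨⟨z', η⟩, h₂⟩⟩, h⟩
    dsimp only at h h₁ h₂ ⊢
    subst h
    exact (A.act_act z γ η h₁ ((A.momentum_act ⟨(z, γ), h₁⟩).symm.trans h₂)).symm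
  s_inv := by
    rintro ⟨⟨z, γ⟩, h⟩
    dsimp only at h ⊢
    rw [A.act_act z γ (𝒢.inv γ) h (𝒢.r_inv γ).symm]
    refine (A.act_congr rfl ?_ _ (𝒢.r_unit _).symm).trans (A.act_unit z)
    rw [𝒢.mul_inv, h]
  r_inv _ := rfl
  mul_assoc p q t h₁ h₂ := Subtype.ext (Prod.ext rfl (𝒢.mul_assoc _ _ _ _ _))
  mul_unit := by
    rintro ⟨⟨z, γ⟩, h⟩
    refine Subtype.ext (Prod.ext rfl ?_)
    refine (𝒢.mul_congr rfl ?_ _ (𝒢.r_unit _).symm).trans (𝒢.mul_unit γ)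
    exact congrArg 𝒢.unit (A.momentum_act ⟨(z, γ), h⟩)
  unit_mul := by
    rintro ⟨⟨z, γ⟩, h⟩
    refine Subtype.ext (Prod.ext rfl ?_)
    exact (𝒢.mul_congr (congrArg 𝒢.unit h) rfl _ (𝒢.s_unit _)).trans (𝒢.unit_mul γ)
  mul_inv := by
    rintro ⟨⟨z, γ⟩, h⟩
    refine Subtype.ext (Prod.ext rfl ?_)
    exact (𝒢.mul_inv γ).trans (congrArg 𝒢.unit h.symm)
  inv_mul := by
    rintro ⟨⟨z, γ⟩, h⟩
    refine Subtype.ext (Prod.ext rfl ?_)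
    exact (𝒢.inv_mul γ).trans (congrArg 𝒢.unit (A.momentum_act ⟨(z, γ), h⟩).symm)
  continuous_s := A.continuous_act
  continuous_r := continuous_fst.comp continuous_subtype_val
  continuous_unit :=
    (continuous_id.prodMk (𝒢.continuous_unit.comp A.continuous_momentum)).subtype_mk _
  continuous_inv := (A.continuous_act.prodMk
    (𝒢.continuous_inv.comp (continuous_snd.comp continuous_subtype_val))).subtype_mk _
  continuous_mul := by
    refine Continuous.subtype_mk (Continuous.prodMk (by fun_prop) ?_) _
    exact 𝒢.continuous_mul.comp (Continuous.subtype_mk (by fun_prop) _)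

open Classical in
/-- The map `z ↦ z · γ` on the fibre over `r γ`, extended by the identity outside that fibre. -/
noncomputable def translate (γ : G) (z : Z) : Z :=
  if h : A.momentum z = 𝒢.r γ then A.act ⟨(z, γ), h⟩ else z

theorem translate_of_eq {γ : G} {z : Z} (h : A.momentum z = 𝒢.r γ) :
    A.translate γ z = A.act ⟨(z, γ), h⟩ := dif_pos h

theorem continuousOn_translate (γ : G) :
    ContinuousOn (A.translate γ) (A.momentum ⁻¹' {𝒢.r γ}) := by
  rw [continuousOn_iff_continuous_domRestrict]
  have : Continuous fun z : (A.momentum ⁻¹' {𝒢.r γ} : Set Z) => A.act ⟨(z.1, γ), z.2⟩ :=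
    A.continuous_act.comp (Continuous.subtype_mk (by fun_prop) _)
  refine this.congr fun z => ?_
  exact (A.translate_of_eq z.2).symm

end RightAction

end TopGroupoid

open MeasureTheory

/-- For `π : Y → X`, the Radon probability measures on `Y` whose support lies in a single fibre
of `π`. -/
structure FibreProb {X : Type v} {Y : Type w} [TopologicalSpace Y] [MeasurableSpace Y]
    (π : Y → X) where
  toMeasure : Measure Y
  isProbabilityMeasure : IsProbabilityMeasure toMeasure
  regular : toMeasure.Regular
  exists_fibre : ∃ x, toMeasure.support ⊆ π ⁻¹' {x}

namespace FibreProb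

variable {X : Type v} {Y : Type w} [TopologicalSpace Y] [MeasurableSpace Y] {π : Y → X}

instance (μ : FibreProb π) : IsProbabilityMeasure μ.toMeasure := μ.isProbabilityMeasure

instance (μ : FibreProb π) : μ.toMeasure.Regular := μ.regular

/-- The weak-* topology: the coarsest one for which `μ ↦ ∫ f dμ` is continuous for every
continuous `f : Y → ℂ` vanishing at infinity. -/
noncomputable instance : TopologicalSpace (FibreProb π) :=
  TopologicalSpace.induced (fun μ (f : C₀(Y, ℂ)) => ∫ y, f y ∂μ.toMeasure) inferInstance

/-- The point whose fibre carries `μ`. -/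
noncomputable def base (μ : FibreProb π) : X := μ.exists_fibre.choose

theorem support_subset (μ : FibreProb π) : μ.toMeasure.support ⊆ π ⁻¹' {μ.base} :=
  μ.exists_fibre.choose_spec

theorem ext' {μ ν : FibreProb π} (h : μ.toMeasure = ν.toMeasure) : μ = ν := by
  cases μ; cases ν; cases h; rfl

theorem ae_mem_fibre (μ : FibreProb π) : ∀ᵐ y ∂μ.toMeasure, π y = μ.base :=
  Filter.mem_of_superset Measure.support_mem_ae_of_regular μ.support_subset

theorem base_eq (μ : FibreProb π) {x : X} (h : ∀ᵐ y ∂μ.toMeasure, π y = x) : μ.base = x := by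
  obtain ⟨y, h₁, h₂⟩ := (μ.ae_mem_fibre.and h).exists
  exact h₁.symm.trans h₂

theorem continuous_integral (f : C₀(Y, ℂ)) :
    Continuous fun μ : FibreProb π => ∫ y, f y ∂μ.toMeasure := by
  have h : Continuous fun (μ : FibreProb π) (f : C₀(Y, ℂ)) => ∫ y, f y ∂μ.toMeasure :=
    continuous_induced_dom
  exact (continuous_apply f).comp h

theorem continuous_integral_of_hasCompactSupport {f : Y → ℂ} (hf : Continuous f)
    (hf' : HasCompactSupport f) : Continuous fun μ : FibreProb π => ∫ y, f y ∂μ.toMeasure :=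
  continuous_integral ⟨⟨f, hf⟩, hf'.is_zero_at_infty⟩

/-- The canonical map from measures to base points is continuous when `π` is proper. -/
theorem continuous_base [TopologicalSpace X] [T2Space Y] [LocallyCompactSpace Y] [BorelSpace Y]
    (hπ : IsProperMap π) [T1Space X] : Continuous (base : FibreProb π → X) := by
  rw [continuous_iff_continuousAt]
  intro μ₀ U hU
  obtain ⟨V, hVU, hVo, hxV⟩ := mem_nhds_iff.1 hU
  obtain ⟨f, hf1, hf0, hfc, -⟩ := exists_continuous_one_zero_of_isCompact
    (hπ.isCompact_preimage (isCompact_singleton (x := μ₀.base)))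
    ((hVo.preimage hπ.continuous).isClosed_compl)
    (Set.disjoint_compl_right_iff_subset.2
      (Set.preimage_mono (Set.singleton_subset_iff.2 hxV)))
  have hc : Continuous fun μ : FibreProb π => ∫ y, ((f y : ℝ) : ℂ) ∂μ.toMeasure :=
    continuous_integral_of_hasCompactSupport (by fun_prop)
      (hfc.comp_left (g := fun t : ℝ => (t : ℂ)) Complex.ofReal_zero)
  have h1 : ∫ y, ((f y : ℝ) : ℂ) ∂μ₀.toMeasure = 1 := by
    rw [integral_congr_ae (g := fun _ => (1 : ℂ))]
    · simp
    · filter_upwards [μ₀.ae_mem_fibre] with y hy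
      simp [hf1 (show y ∈ π ⁻¹' {μ₀.base} from hy)]
  have hne : ∀ᶠ μ in 𝓝 μ₀, ∫ y, ((f y : ℝ) : ℂ) ∂(FibreProb.toMeasure μ) ≠ 0 :=
    hc.continuousAt.eventually_ne (by rw [h1]; exact one_ne_zero)
  rw [Filter.mem_map]
  filter_upwards [hne] with μ hμ
  by_contra hb
  refine hμ (integral_eq_zero_of_ae ?_)
  filter_upwards [μ.ae_mem_fibre] with y hy
  have hyV : y ∈ (π ⁻¹' V)ᶜ := fun h => hb (hVU (by rw [← hy]; exact h))
  simp [hf0 hyV]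

end FibreProb

namespace TopGroupoid.RightAction

variable {G : Type u} {X : Type v} [TopologicalSpace G] [TopologicalSpace X] [T2Space G]
  {𝒢 : TopGroupoid G X} {Y : Type w} [TopologicalSpace Y] (A : 𝒢.RightAction Y)

theorem isClosed_fibre (x : X) : IsClosed (A.momentum ⁻¹' {x}) :=
  haveI := 𝒢.t2Space_unitSpace
  isClosed_singleton.preimage A.continuous_momentum

variable [MeasurableSpace Y] [BorelSpace Y]

theorem measurable_translate (γ : G) : Measurable (A.translate γ) := by
  classical
  exact Measurable.dite (s := A.momentum ⁻¹' {𝒢.r γ})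
    (f := fun z => A.act ⟨(z.1, γ), z.2⟩) (g := fun z => z.1)
    (A.continuous_act.comp (Continuous.subtype_mk (by fun_prop) _)).measurable
    measurable_subtype_coe (A.isClosed_fibre _).measurableSet

theorem regular_map_translate [T2Space Y] (μ : FibreProb A.momentum) (γ : G) (h : μ.base = 𝒢.r γ) :
    (μ.toMeasure.map (A.translate γ)).Regular := by
  have hm := A.measurable_translate γ
  have : IsProbabilityMeasure (μ.toMeasure.map (A.translate γ)) :=
    Measure.isProbabilityMeasure_map hm.aemeasurable
  have : (μ.toMeasure.map (A.translate γ)).InnerRegular := by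
    refine ⟨fun B hB t ht => ?_⟩
    have hF : MeasurableSet (A.momentum ⁻¹' {𝒢.r γ}) := (A.isClosed_fibre _).measurableSet
    have hae : A.momentum ⁻¹' {𝒢.r γ} ∈ ae μ.toMeasure := by
      filter_upwards [μ.ae_mem_fibre] with y hy
      exact hy.trans h
    rw [Measure.map_apply hm hB, ← Measure.measure_inter_eq_of_ae hae] at ht
    obtain ⟨K, hK, hKc, htK⟩ := (hF.inter (hm hB)).exists_lt_isCompact_of_ne_top
      (measure_ne_top _ _) ht
    have hKc' : IsCompact (A.translate γ '' K) := hKc.image_of_continuousOn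
      ((A.continuousOn_translate γ).mono fun y hy => (hK hy).1)
    refine ⟨A.translate γ '' K, ?_, hKc', ?_⟩
    · rintro _ ⟨y, hy, rfl⟩
      exact (hK hy).2
    · rw [Measure.map_apply hm hKc'.measurableSet]
      exact htK.trans_le (measure_mono (Set.subset_preimage_image _ _))
  infer_instance

theorem ae_map_translate (μ : FibreProb A.momentum) (γ : G) (h : μ.base = 𝒢.r γ) :
    ∀ᵐ y ∂(μ.toMeasure.map (A.translate γ)), A.momentum y = 𝒢.s γ := by
  refine (ae_map_iff (A.measurable_translate γ).aemeasurable
    (A.isClosed_fibre (𝒢.s γ)).measurableSet).2 ?_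
  filter_upwards [μ.ae_mem_fibre] with y hy
  rw [A.translate_of_eq (hy.trans h)]
  exact A.momentum_act _

variable [T2Space Y]

/-- The measure `μ · γ`: the push-forward of `μ`, which is carried by the fibre over `r γ`, under
`z ↦ z · γ`. -/
noncomputable def pushMeasure (p : {p : FibreProb A.momentum × G // p.1.base = 𝒢.r p.2}) :
    FibreProb A.momentum where
  toMeasure := p.1.1.toMeasure.map (A.translate p.1.2)
  isProbabilityMeasure :=
    Measure.isProbabilityMeasure_map (A.measurable_translate p.1.2).aemeasurable
  regular := A.regular_map_translate p.1.1 p.1.2 p.2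
  exists_fibre := ⟨𝒢.s p.1.2, Measure.support_subset_of_isClosed (A.isClosed_fibre _)
    (A.ae_map_translate p.1.1 p.1.2 p.2)⟩

theorem integral_pushMeasure (p : {p : FibreProb A.momentum × G // p.1.base = 𝒢.r p.2})
    {f : Y → ℂ} (hf : Continuous f) :
    ∫ y, f y ∂(A.pushMeasure p).toMeasure =
      ∫ z, f (A.translate p.1.2 z) ∂p.1.1.toMeasure :=
  integral_map (A.measurable_translate p.1.2).aemeasurable hf.aestronglyMeasurable

theorem continuous_pushMeasure [LocallyCompactSpace G] (h𝒢 : 𝒢.IsEtale)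
    (hA : IsProperMap A.momentum) : Continuous A.pushMeasure := by
  have := 𝒢.t2Space_unitSpace
  have := h𝒢.locallyCompactSpace_unitSpace
  rw [continuous_induced_rng]
  refine continuous_pi fun f => ?_
  rw [continuous_iff_continuousAt]
  rintro ⟨⟨μ₀, γ₀⟩, h₀⟩
  obtain ⟨e, heγ, her⟩ := h𝒢.r_isLocalHomeomorph γ₀
  have hx₀ : 𝒢.r γ₀ ∈ e.target := by rw [her]; exact e.map_source heγ
  obtain ⟨K, hK, hKt, hKx⟩ : ∃ K, IsCompact K ∧ K ⊆ e.target ∧ K ∈ 𝓝 (𝒢.r γ₀) := by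
    obtain ⟨K, h1, h2, h3⟩ := local_compact_nhds (e.open_target.mem_nhds hx₀)
    exact ⟨K, h3, h2, h1⟩
  obtain ⟨L, hL, hLK, hLx⟩ : ∃ L, IsCompact L ∧ L ⊆ interior K ∧ L ∈ 𝓝 (𝒢.r γ₀) := by
    obtain ⟨L, h1, h2, h3⟩ := local_compact_nhds (interior_mem_nhds.2 hKx)
    exact ⟨L, h3, h2, h1⟩
  obtain ⟨b, hb1, hb0, -, -⟩ := exists_continuous_one_zero_of_isCompact hL
    isOpen_interior.isClosed_compl (Set.disjoint_compl_right_iff_subset.2 hLK)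
  have hbs : ∀ z, z ∉ K → b z = 0 := fun z hz => hb0 fun h => hz (interior_subset h)
  let g : Y → ℂ := fun z =>
    (b (A.momentum z) : ℂ) * f (A.translate (e.symm (A.momentum z)) z)
  have hgs : Function.support g ⊆ A.momentum ⁻¹' K := by
    intro z hz
    by_contra h
    exact hz (by simp [g, hbs _ h])
  have hgt : tsupport g ⊆ A.momentum ⁻¹' K :=
    closure_minimal hgs (hK.isClosed.preimage A.continuous_momentum)
  have hgcs : HasCompactSupport g :=
    (hA.isCompact_preimage hK).of_isClosed_subset (isClosed_tsupport g) hgt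
  have hre : ∀ x ∈ e.target, 𝒢.r (e.symm x) = x := fun x hx => by
    rw [her]; exact e.right_inv hx
  have hgc : Continuous g := by
    refine continuous_of_tsupport fun z hz => ?_
    have hzt : z ∈ A.momentum ⁻¹' e.target := hKt (hgt hz)
    have hop : IsOpen (A.momentum ⁻¹' e.target) := e.open_target.preimage A.continuous_momentum
    refine ContinuousOn.continuousAt (s := A.momentum ⁻¹' e.target) ?_ (hop.mem_nhds hzt)
    refine ContinuousOn.mul ?_ ?_
    · exact (Complex.continuous_ofReal.comp (b.continuous.comp A.continuous_momentum)).continuousOn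
    · refine f.continuous.comp_continuousOn ?_
      rw [continuousOn_iff_continuous_domRestrict]
      have hsy : Continuous fun z : (A.momentum ⁻¹' e.target : Set Y) =>
          e.symm (A.momentum z.1) :=
        e.continuousOn_symm.comp_continuous
          (A.continuous_momentum.comp continuous_subtype_val) fun z => z.2
      have hac : Continuous fun z : (A.momentum ⁻¹' e.target : Set Y) =>
          A.act ⟨(z.1, e.symm (A.momentum z.1)), (hre _ z.2).symm⟩ :=
        A.continuous_act.comp ((continuous_subtype_val.prodMk hsy).subtype_mk _)
      exact hac.congr fun z => (A.translate_of_eq (hre _ z.2).symm).symm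
  have hG : Continuous fun p : {p : FibreProb A.momentum × G // p.1.base = 𝒢.r p.2} =>
      ∫ y, g y ∂p.1.1.toMeasure :=
    (FibreProb.continuous_integral_of_hasCompactSupport hgc hgcs).comp
      (continuous_fst.comp continuous_subtype_val)
  refine hG.continuousAt.congr ?_
  have hγc : Continuous fun p : {p : FibreProb A.momentum × G // p.1.base = 𝒢.r p.2} => p.1.2 :=
    continuous_snd.comp continuous_subtype_val
  have hev₁ := hγc.continuousAt.preimage_mem_nhds (x := ⟨⟨μ₀, γ₀⟩, h₀⟩)
    (e.open_source.mem_nhds heγ)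
  have hev₂ := (𝒢.continuous_r.comp hγc).continuousAt.preimage_mem_nhds
    (x := ⟨⟨μ₀, γ₀⟩, h₀⟩) hLx
  filter_upwards [hev₁, hev₂] with p hp₁ hp₂
  refine Eq.trans ?_ (A.integral_pushMeasure p f.continuous).symm
  refine integral_congr_ae ?_
  filter_upwards [p.1.1.ae_mem_fibre] with y hy
  have hy' : A.momentum y = 𝒢.r p.1.2 := hy.trans p.2
  have h1 : b (𝒢.r p.1.2) = 1 := hb1 hp₂
  have h2 : e.symm (𝒢.r p.1.2) = p.1.2 := by
    have := e.left_inv hp₁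
    rwa [← her] at this
  simp only [g]
  rw [hy', h1, h2]
  simp

/-- The right action of `𝒢` on the space of Radon probability measures carried by the fibres of the
momentum map of a proper `𝒢`-space `Y`. -/
noncomputable def onFibreProb [LocallyCompactSpace G] [LocallyCompactSpace Y] (h𝒢 : 𝒢.IsEtale)
    (hA : IsProperMap A.momentum) : 𝒢.RightAction (FibreProb A.momentum) where
  momentum := FibreProb.base
  act := A.pushMeasure
  momentum_act p := FibreProb.base_eq _ (A.ae_map_translate p.1.1 p.1.2 p.2)
  act_unit μ := by
    refine FibreProb.ext' ?_
    refine (Measure.map_congr (g := id) ?_).trans Measure.map_id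
    filter_upwards [μ.ae_mem_fibre] with y hy
    have h : A.momentum y = 𝒢.r (𝒢.unit μ.base) := hy.trans (𝒢.r_unit _).symm
    refine (A.translate_of_eq h).trans ?_
    exact (A.act_congr rfl (congrArg 𝒢.unit hy.symm) _ (𝒢.r_unit _).symm).trans (A.act_unit y)
  act_act μ γ η h₁ h₂ := by
    refine FibreProb.ext' ?_
    refine (Measure.map_map (A.measurable_translate η) (A.measurable_translate γ)).trans ?_
    refine Measure.map_congr ?_
    filter_upwards [μ.ae_mem_fibre] with y hy
    have hy₁ : A.momentum y = 𝒢.r γ := hy.trans h₁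
    have hy₂ : A.momentum (A.act ⟨(y, γ), hy₁⟩) = 𝒢.r η := (A.momentum_act _).trans h₂
    have hy₃ : A.momentum y = 𝒢.r (𝒢.mul ⟨(γ, η), h₂⟩) := hy₁.trans (𝒢.r_mul ⟨(γ, η), h₂⟩).symm
    rw [Function.comp_apply, A.translate_of_eq hy₁, A.translate_of_eq hy₂, A.translate_of_eq hy₃]
    exact A.act_act y γ η hy₁ h₂
  continuous_momentum :=
    haveI := 𝒢.t2Space_unitSpace
    FibreProb.continuous_base hA
  continuous_act := A.continuous_pushMeasure h𝒢 hA

end TopGroupoid.RightAction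

/-! Integration over fibres carries approximating functions from `Y ⋊ 𝒢` to `M ⋊ 𝒢`: if `φ i` is a
net witnessing amenability of the first groupoid, the averages `(μ, γ) ↦ ∫ φ i (z, γ) dμ(z)` witness
amenability of the second, over the same index set.

Positivity is inherited pointwise. Since `(μ, γₖ)⁻¹ (μ, γₗ) = (μ · γₖ, γₖ⁻¹ γₗ)` and `μ · γₖ` is a
push-forward of `μ`, the quadratic form of the average is the `μ`-integral of the quadratic forms of
`φ i` at the arrows `(z, γₖ)` (`isPositiveType_average`). The bound on units passes through the
integral because `μ` is a probability measure. So does convergence: a compact set of arrows of `M ⋊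
𝒢` involves only `γ` in a compact set, and properness of the momentum map makes the arrows of `Y ⋊
𝒢` over such `γ` compact (`tendstoUniformlyOn_average`).

Continuity uses that `𝒢` is étale: near a given arrow, `γ` is a continuous function of `r γ`, so the
integrand becomes one compactly supported function on `Y`, to which weak-* continuity applies
(`continuous_average`). Compact support needs `M → X` to have compact preimages of compact sets, a
fibrewise form of weak-* compactness of probability measures on a compact space
(`FibreProb.isCompact_preimage_base`). -/

/-! ### Limits of probability measures along ultrafilters -/

open Filter in
/-- Along an ultrafilter, the integrals of compactly supported continuous functions against
probability measures converge to the integral against a regular measure. -/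
theorem exists_regular_tendsto_integral_ultrafilter {ι : Type*} {Y : Type w} [TopologicalSpace Y]
    [T2Space Y] [LocallyCompactSpace Y] [MeasurableSpace Y] [BorelSpace Y] (m : ι → Measure Y)
    [∀ i, IsProbabilityMeasure (m i)] (𝒰 : Ultrafilter ι) :
    ∃ ν : Measure Y, ν.Regular ∧ ∀ f : C(Y, ℝ), HasCompactSupport f →
      Tendsto (fun i => ∫ y, f y ∂(m i)) 𝒰 (𝓝 (∫ y, f y ∂ν)) := by
  -- For fixed `f` the integrals lie in a closed ball, so they converge along the ultrafilter. The
  -- limit is linear and positive in `f`, and Riesz representation yields `ν`. Mass may still escape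
  -- to infinity here.
  have hlim : ∀ f : CompactlySupportedContinuousMap Y ℝ,
      ∃ a, Tendsto (fun i => ∫ y, f y ∂(m i)) 𝒰 (𝓝 a) := fun f => by
    obtain ⟨C, hC⟩ := f.hasCompactSupport.exists_bound_of_continuous f.continuous
    have hb : ∀ i, ∫ y, f y ∂(m i) ∈ Metric.closedBall (0 : ℝ) C := fun i => by
      rw [mem_closedBall_zero_iff]
      simpa using norm_integral_le_of_norm_le_const (ae_of_all (m i) hC)
    obtain ⟨a, -, ha⟩ := (isCompact_closedBall (0 : ℝ) C).ultrafilter_le_nhds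
      (𝒰.map fun i => ∫ y, f y ∂(m i)) (tendsto_principal.2 (Eventually.of_forall hb))
    exact ⟨a, ha⟩
  choose Λ hΛ using hlim
  let L : CompactlySupportedContinuousMap Y ℝ →ₗ[ℝ] ℝ :=
    { toFun := Λ
      map_add' := fun f g => by
        refine tendsto_nhds_unique (hΛ (f + g)) (((hΛ f).add (hΛ g)).congr fun i => ?_)
        exact (integral_add f.integrable g.integrable).symm
      map_smul' := fun c f => by
        refine tendsto_nhds_unique (hΛ (c • f)) (((hΛ f).const_smul c).congr fun i => ?_)
        exact (integral_smul c f).symm }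
  let P : CompactlySupportedContinuousMap Y ℝ →ₚ[ℝ] ℝ := PositiveLinearMap.mk₀ L fun f hf =>
    ge_of_tendsto' (hΛ f) fun i => integral_nonneg hf
  refine ⟨RealRMK.rieszMeasure P, inferInstance, fun f hf => ?_⟩
  have h := RealRMK.integral_rieszMeasure P ⟨f, hf⟩
  have h' : ∫ y, f y ∂(RealRMK.rieszMeasure P) = Λ ⟨f, hf⟩ := h
  rw [h']
  exact hΛ ⟨f, hf⟩

/-- A regular measure on a locally compact Hausdorff space is a probability measure as soon as
every compact set is dominated by a compactly supported function of integral one. -/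
theorem isProbabilityMeasure_of_integral_eq_one {Y : Type w} [TopologicalSpace Y]
    [T2Space Y] [LocallyCompactSpace Y] [MeasurableSpace Y] [BorelSpace Y] (ν : Measure Y)
    [ν.Regular] (h : ∀ K : Set Y, IsCompact K → ∃ f : C(Y, ℝ), HasCompactSupport f ∧
      Set.EqOn f 1 K ∧ (∀ y, f y ∈ Set.Icc (0 : ℝ) 1) ∧ ∫ y, f y ∂ν = 1) :
    IsProbabilityMeasure ν := by
  have key : ∀ K : Set Y, IsCompact K → ν K ≤ 1 := fun K hK => by
    obtain ⟨f, hfc, hf1, hf01, hfi⟩ := h K hK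
    have hint : Integrable f ν := f.continuous.integrable_of_hasCompactSupport hfc
    rw [← ENNReal.ofReal_one, ← hfi,
      ofReal_integral_eq_lintegral_ofReal hint (ae_of_all _ fun y => (hf01 y).1),
      ← lintegral_indicator_one hK.measurableSet]
    refine lintegral_mono fun y => ?_
    by_cases hy : y ∈ K
    · simp [hy, hf1 hy]
    · simp [hy]
  refine ⟨le_antisymm ?_ ?_⟩
  · rw [isOpen_univ.measure_eq_iSup_isCompact ν]
    exact iSup₂_le fun K _ => iSup_le fun hK => key K hK
  -- Any function bounded by one with integral one forces mass at least one, so the empty compact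
  -- set suffices.
  · obtain ⟨f, hfc, -, hf01, hfi⟩ := h ∅ isCompact_empty
    have hint : Integrable f ν := f.continuous.integrable_of_hasCompactSupport hfc
    rw [← ENNReal.ofReal_one, ← hfi,
      ofReal_integral_eq_lintegral_ofReal hint (ae_of_all _ fun y => (hf01 y).1),
      ← lintegral_one]
    refine lintegral_mono fun y => ?_
    simpa using (hf01 y).2

/-! ### Compactness of the measures based over a compact set -/

namespace FibreProb

variable {X : Type v} {Y : Type w} [TopologicalSpace Y] [MeasurableSpace Y] {π : Y → X}

open Filter in
/-- Weak-* convergence in `FibreProb π` can be tested on compactly supported real functions, as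
long as the base points stay in a compact set. -/
theorem tendsto_nhds_of_hasCompactSupport [TopologicalSpace X] [T2Space Y] [LocallyCompactSpace Y]
    [BorelSpace Y] (hπ : IsProperMap π) {K : Set X} (hK : IsCompact K) {l : Filter (FibreProb π)}
    (hl : ∀ᶠ μ in l, μ.base ∈ K) {ν : FibreProb π} (hν : ν.base ∈ K)
    (h : ∀ f : C(Y, ℝ), HasCompactSupport f →
      Tendsto (fun μ : FibreProb π => ∫ y, f y ∂μ.toMeasure) l (𝓝 (∫ y, f y ∂ν.toMeasure))) :
    l ≤ 𝓝 ν := by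
  rw [nhds_induced, ← tendsto_iff_comap, tendsto_pi_nhds]
  intro f
  -- Multiplying by `b` makes a function vanishing at infinity compactly supported, without changing
  -- its integral against measures based in `K`.
  obtain ⟨b, hb1, -, hbc, -⟩ := exists_continuous_one_zero_of_isCompact
    (hπ.isCompact_preimage hK) isClosed_empty (Set.disjoint_empty _)
  have hcont : Continuous fun y => (b y : ℂ) * f y := by fun_prop
  have hsupp : HasCompactSupport fun y => (b y : ℂ) * f y :=
    (hbc.comp_left (g := fun t : ℝ => (t : ℂ)) Complex.ofReal_zero).mul_right
  have hcut : ∀ μ : FibreProb π, μ.base ∈ K →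
      ∫ y, f y ∂μ.toMeasure = ∫ y, (b y : ℂ) * f y ∂μ.toMeasure := fun μ hμ => by
    refine integral_congr_ae ?_
    filter_upwards [μ.ae_mem_fibre] with y hy
    have : b y = 1 := hb1 (show π y ∈ K by rwa [hy])
    simp [this]
  let g₁ : C(Y, ℝ) := ⟨fun y => ((b y : ℂ) * f y).re, Complex.continuous_re.comp hcont⟩
  let g₂ : C(Y, ℝ) := ⟨fun y => ((b y : ℂ) * f y).im, Complex.continuous_im.comp hcont⟩
  have hsplit : ∀ μ : FibreProb π, ∫ y, (b y : ℂ) * f y ∂μ.toMeasure =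
      ((∫ y, g₁ y ∂μ.toMeasure : ℝ) : ℂ) +
        ((∫ y, g₂ y ∂μ.toMeasure : ℝ) : ℂ) * Complex.I := fun μ =>
    (integral_re_add_im (hcont.integrable_of_hasCompactSupport hsupp)).symm
  have hg₁ : HasCompactSupport g₁ := hsupp.comp_left (g := Complex.re) Complex.zero_re
  have hg₂ : HasCompactSupport g₂ := hsupp.comp_left (g := Complex.im) Complex.zero_im
  have hre := h g₁ hg₁
  have him := h g₂ hg₂
  have hlim := hre.ofReal.add (him.ofReal.mul_const Complex.I)
  rw [← hsplit ν, ← hcut ν hν] at hlim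
  refine Tendsto.congr' ?_ hlim
  filter_upwards [hl] with μ hμ
  exact (hsplit μ).symm.trans (hcut μ hμ).symm

open Filter in
/-- The canonical map from measures to base points has compact preimages of compact sets when
`π` is proper. -/
theorem isCompact_preimage_base [TopologicalSpace X] [T2Space X] [T2Space Y] [LocallyCompactSpace Y]
    [BorelSpace Y] (hπ : IsProperMap π) {K : Set X} (hK : IsCompact K) :
    IsCompact (base ⁻¹' K : Set (FibreProb π)) := by
  rw [isCompact_iff_ultrafilter_le_nhds]
  intro 𝒰 h𝒰
  have hl : ∀ᶠ μ in (𝒰 : Filter (FibreProb π)), μ.base ∈ K := le_principal_iff.1 h𝒰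
  obtain ⟨x, hxK, hx⟩ := hK.ultrafilter_le_nhds (𝒰.map base) (tendsto_principal.2 hl)
  have hx' : Tendsto base (𝒰 : Filter (FibreProb π)) (𝓝 x) := hx
  obtain ⟨ν, hreg, hν⟩ := exists_regular_tendsto_integral_ultrafilter
    (fun μ : FibreProb π => μ.toMeasure) 𝒰
  have hprob : IsProbabilityMeasure ν := by
    refine isProbabilityMeasure_of_integral_eq_one ν fun C hC => ?_
    -- Enlarging `C` by the compact set `π ⁻¹' K` prevents loss of mass: `f` then has integral one
    -- against every measure based in `K`, hence against `ν`.
    obtain ⟨f, hf1, -, hfc, hf01⟩ := exists_continuous_one_zero_of_isCompact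
      (hC.union (hπ.isCompact_preimage hK)) isClosed_empty (Set.disjoint_empty _)
    refine ⟨f, hfc, hf1.mono Set.subset_union_left, hf01,
      tendsto_nhds_unique (hν f hfc) (tendsto_const_nhds.congr' ?_)⟩
    filter_upwards [hl] with μ hμ
    rw [integral_congr_ae (g := fun _ => (1 : ℝ))]
    · simp
    · filter_upwards [μ.ae_mem_fibre] with y hy
      exact hf1 (Or.inr (show π y ∈ K by rwa [hy]))
  have hsupp : ν.support ⊆ π ⁻¹' {x} := by
    intro y hy
    by_contra hne
    -- A bump function at `y` living over `U` has integral zero against measures based in `V`, which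
    -- is eventually the case. Its `ν`-integral is therefore zero, and `ν` vanishes near `y`.
    obtain ⟨U, V, hU, hV, hyU, hxV, hUV⟩ := t2_separation (show π y ≠ x from hne)
    obtain ⟨C, hCn, hCU, hC⟩ := local_compact_nhds ((hU.preimage hπ.continuous).mem_nhds hyU)
    obtain ⟨f, hf1, hf0, hfc, hf01⟩ := exists_continuous_one_zero_of_isCompact hC
      (hU.preimage hπ.continuous).isClosed_compl (Set.disjoint_compl_right_iff_subset.2 hCU)
    have hzero : ∫ y, f y ∂ν = 0 := by
      refine tendsto_nhds_unique (hν f hfc) (tendsto_const_nhds.congr' ?_)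
      filter_upwards [hx'.eventually (hV.mem_nhds hxV)] with μ hμ
      refine (integral_eq_zero_of_ae ?_).symm
      filter_upwards [μ.ae_mem_fibre] with z hz
      exact hf0 fun hzU => hUV.le_bot ⟨hzU, show π z ∈ V by rwa [hz]⟩
    have hae := (integral_eq_zero_iff_of_nonneg (fun z => (hf01 z).1)
      (f.continuous.integrable_of_hasCompactSupport hfc)).1 hzero
    refine ((Measure.mem_support_iff_forall y).1 hy C hCn).ne' (measure_mono_null ?_ hae)
    intro z hz h0
    exact one_ne_zero ((hf1 hz).symm.trans h0)
  let ν' : FibreProb π := ⟨ν, hprob, hreg, x, hsupp⟩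
  have hb : ν'.base = x :=
    ν'.base_eq (Filter.mem_of_superset Measure.support_mem_ae_of_regular hsupp)
  refine ⟨ν', show ν'.base ∈ K by rwa [hb], ?_⟩
  exact tendsto_nhds_of_hasCompactSupport hπ hK hl (by rwa [hb]) hν

end FibreProb

/-! ### Slices of functions on the arrows of a transformation groupoid -/

namespace TopGroupoid.RightAction

section Arrows

variable {G : Type u} {X : Type v} [TopologicalSpace G] [TopologicalSpace X]
  {𝒢 : TopGroupoid G X} {Z : Type w} [TopologicalSpace Z] (A : 𝒢.RightAction Z)

/-- When the momentum map has compact preimages of compact sets, the arrows `(z, γ)` with `γ` in a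
given compact set form a compact set. -/
theorem isCompact_arrows [T2Space X] {K : Set G} (hK : IsCompact K)
    (hA : IsCompact (A.momentum ⁻¹' (𝒢.r '' K))) : IsCompact {p : A.Arrows | p.1.2 ∈ K} := by
  have hcl : IsClosed {p : Z × G | A.momentum p.1 = 𝒢.r p.2} :=
    isClosed_eq (A.continuous_momentum.comp continuous_fst) (𝒢.continuous_r.comp continuous_snd)
  have h := hcl.isClosedEmbedding_subtypeVal.isCompact_preimage (hA.prod hK)
  have heq : {p : A.Arrows | p.1.2 ∈ K} =
      Subtype.val ⁻¹' ((A.momentum ⁻¹' (𝒢.r '' K)) ×ˢ K) :=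
    Set.ext fun p => ⟨fun hp => ⟨⟨p.1.2, hp, p.2.symm⟩, hp⟩, fun hp => hp.2⟩
  rw [heq]
  exact h

open Classical in
/-- The restriction of a function on the arrow space of `Z ⋊ 𝒢` to the arrows `(z, γ)` with `γ`
fixed, extended by zero to all of `Z`. -/
noncomputable def sliceAt (φ : A.Arrows → ℂ) (γ : G) (z : Z) : ℂ :=
  if h : A.momentum z = 𝒢.r γ then φ ⟨(z, γ), h⟩ else 0

theorem sliceAt_of_eq (φ : A.Arrows → ℂ) {γ : G} {z : Z} (h : A.momentum z = 𝒢.r γ) :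
    A.sliceAt φ γ z = φ ⟨(z, γ), h⟩ := dif_pos h

theorem norm_sliceAt_le {φ : A.Arrows → ℂ} {C : ℝ} (hC : 0 ≤ C) (h : ∀ p, ‖φ p‖ ≤ C)
    (γ : G) (z : Z) : ‖A.sliceAt φ γ z‖ ≤ C := by
  unfold sliceAt
  split_ifs with hz
  · exact h _
  · simpa using hC

theorem measurable_sliceAt [T2Space G] [MeasurableSpace Z] [BorelSpace Z] {φ : A.Arrows → ℂ}
    (hφ : Continuous φ) (γ : G) : Measurable (A.sliceAt φ γ) := by
  classical
  exact Measurable.dite (s := A.momentum ⁻¹' {𝒢.r γ})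
    (f := fun z => φ ⟨(z.1, γ), z.2⟩) (g := fun _ => 0)
    (hφ.comp (Continuous.subtype_mk (by fun_prop) _)).measurable
    measurable_const (A.isClosed_fibre _).measurableSet

theorem integrable_sliceAt [T2Space G] [MeasurableSpace Z] [BorelSpace Z] {φ : A.Arrows → ℂ}
    (hφ : Continuous φ) (hφc : HasCompactSupport φ) (γ : G) (μ : Measure Z) [IsFiniteMeasure μ] :
    Integrable (A.sliceAt φ γ) μ := by
  obtain ⟨C, hC⟩ := hφc.exists_bound_of_continuous hφ
  -- `C` may be negative if there are no arrows, while the slice still takes its default value `0`.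
  exact Integrable.of_bound (A.measurable_sliceAt hφ γ).aestronglyMeasurable (max C 0)
    (ae_of_all _ fun z => A.norm_sliceAt_le (le_max_right _ _)
      (fun p => (hC p).trans (le_max_left _ _)) γ z)

end Arrows

/-! ### Averages over fibre measures -/

variable {G : Type u} {X : Type v} [TopologicalSpace G] [TopologicalSpace X] [T2Space G]
  {𝒢 : TopGroupoid G X} {Y : Type w} [TopologicalSpace Y] (A : 𝒢.RightAction Y)
  [MeasurableSpace Y]

/-- The average `(μ, γ) ↦ ∫ φ (z, γ) dμ(z)` of a function on the arrow space of `Y ⋊ 𝒢`. -/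
noncomputable def average (φ : A.Arrows → ℂ)
    (p : {p : FibreProb A.momentum × G // p.1.base = 𝒢.r p.2}) : ℂ :=
  ∫ z, A.sliceAt φ p.1.2 z ∂p.1.1.toMeasure

/-- The range map has a continuous local section near `γ₀`. Substituting it for `γ` removes the
dependence of the integrand on `γ`, and a cutoff on `X` gives compact support because the momentum
map is proper. -/
theorem continuous_average [T2Space Y] [LocallyCompactSpace G] (h𝒢 : 𝒢.IsEtale)
    (hA : IsProperMap A.momentum) {φ : A.Arrows → ℂ} (hφ : Continuous φ) :
    Continuous (A.average φ) := by
  have := 𝒢.t2Space_unitSpace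
  have := h𝒢.locallyCompactSpace_unitSpace
  rw [continuous_iff_continuousAt]
  rintro ⟨⟨μ₀, γ₀⟩, h₀⟩
  obtain ⟨e, heγ, her⟩ := h𝒢.r_isLocalHomeomorph γ₀
  have hx₀ : 𝒢.r γ₀ ∈ e.target := by rw [her]; exact e.map_source heγ
  obtain ⟨K, hKx, hKt, hK⟩ := local_compact_nhds (e.open_target.mem_nhds hx₀)
  obtain ⟨L, hLx, hLK, hL⟩ := local_compact_nhds (interior_mem_nhds.2 hKx)
  obtain ⟨b, hb1, hb0, -, -⟩ := exists_continuous_one_zero_of_isCompact hL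
    isOpen_interior.isClosed_compl (Set.disjoint_compl_right_iff_subset.2 hLK)
  -- `e.symm` is the local section of `𝒢.r` through `γ₀`. The cutoff `b` is one on the neighbourhood
  -- `L` of `r γ₀` and vanishes outside `K`, so `g` is supported over `K`, where the section is
  -- defined.
  let g : Y → ℂ := fun z =>
    (b (A.momentum z) : ℂ) * A.sliceAt φ (e.symm (A.momentum z)) z
  have hgs : Function.support g ⊆ A.momentum ⁻¹' K := by
    intro z hz
    by_contra h
    have hbz : b (A.momentum z) = 0 := hb0 fun h' => h (interior_subset (s := K) h')
    exact hz (by simp [g, hbz])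
  have hgt : tsupport g ⊆ A.momentum ⁻¹' K :=
    closure_minimal hgs (hK.isClosed.preimage A.continuous_momentum)
  have hgcs : HasCompactSupport g :=
    (hA.isCompact_preimage hK).of_isClosed_subset (isClosed_tsupport g) hgt
  have hre : ∀ x ∈ e.target, 𝒢.r (e.symm x) = x := fun x hx => by
    rw [her]; exact e.right_inv hx
  have hgc : Continuous g := by
    refine continuous_of_tsupport fun z hz => ?_
    have hop : IsOpen (A.momentum ⁻¹' e.target) := e.open_target.preimage A.continuous_momentum
    refine ContinuousOn.continuousAt (s := A.momentum ⁻¹' e.target) ?_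
      (hop.mem_nhds (hKt (hgt hz)))
    refine ContinuousOn.mul ?_ ?_
    · exact (Complex.continuous_ofReal.comp (b.continuous.comp A.continuous_momentum)).continuousOn
    · rw [continuousOn_iff_continuous_domRestrict]
      have hsy : Continuous fun z : (A.momentum ⁻¹' e.target : Set Y) =>
          e.symm (A.momentum z.1) :=
        e.continuousOn_symm.comp_continuous
          (A.continuous_momentum.comp continuous_subtype_val) fun z => z.2
      have hac : Continuous fun z : (A.momentum ⁻¹' e.target : Set Y) =>
          φ ⟨(z.1, e.symm (A.momentum z.1)), (hre _ z.2).symm⟩ :=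
        hφ.comp ((continuous_subtype_val.prodMk hsy).subtype_mk _)
      exact hac.congr fun z => (A.sliceAt_of_eq φ (hre _ z.2).symm).symm
  have hG : Continuous fun p : {p : FibreProb A.momentum × G // p.1.base = 𝒢.r p.2} =>
      ∫ y, g y ∂p.1.1.toMeasure :=
    (FibreProb.continuous_integral_of_hasCompactSupport hgc hgcs).comp
      (continuous_fst.comp continuous_subtype_val)
  refine hG.continuousAt.congr ?_
  have hγc : Continuous fun p : {p : FibreProb A.momentum × G // p.1.base = 𝒢.r p.2} => p.1.2 :=
    continuous_snd.comp continuous_subtype_val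
  have hev₁ := hγc.continuousAt.preimage_mem_nhds (x := ⟨⟨μ₀, γ₀⟩, h₀⟩)
    (e.open_source.mem_nhds heγ)
  have hev₂ := (𝒢.continuous_r.comp hγc).continuousAt.preimage_mem_nhds
    (x := ⟨⟨μ₀, γ₀⟩, h₀⟩) hLx
  filter_upwards [hev₁, hev₂] with p hp₁ hp₂
  refine integral_congr_ae ?_
  -- On the fibre carrying the measure, the section returns `γ` itself and the cutoff is one, so `g`
  -- agrees with the slice.
  filter_upwards [p.1.1.ae_mem_fibre] with y hy
  have h1 : b (𝒢.r p.1.2) = 1 := hb1 hp₂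
  have h2 : e.symm (𝒢.r p.1.2) = p.1.2 := by
    have := e.left_inv hp₁
    rwa [← her] at this
  simp only [g]
  rw [hy.trans p.2, h1, h2]
  simp

variable [BorelSpace Y]

theorem average_pushMeasure [T2Space Y] {φ : A.Arrows → ℂ} (hφ : Continuous φ)
    (p : {p : FibreProb A.momentum × G // p.1.base = 𝒢.r p.2}) (γ : G)
    (h : (A.pushMeasure p).base = 𝒢.r γ) : A.average φ ⟨(A.pushMeasure p, γ), h⟩ =
      ∫ z, A.sliceAt φ γ (A.translate p.1.2 z) ∂p.1.1.toMeasure :=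
  integral_map (A.measurable_translate p.1.2).aemeasurable
    (A.measurable_sliceAt hφ γ).aestronglyMeasurable

theorem tendstoUniformlyOn_average (hA : IsProperMap A.momentum) {I : Type*} {l : Filter I}
    {φ : I → A.Arrows → ℂ} (hφ : ∀ i, Continuous (φ i)) (hφc : ∀ i, HasCompactSupport (φ i))
    (hlim : ∀ K : Set A.Arrows, IsCompact K → TendstoUniformlyOn φ (fun _ => 1) l K)
    {K : Set {p : FibreProb A.momentum × G // p.1.base = 𝒢.r p.2}} (hK : IsCompact K) :
    TendstoUniformlyOn (fun i => A.average (φ i)) (fun _ => 1) l K := by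
  have := 𝒢.t2Space_unitSpace
  have hKG : IsCompact ((fun p : {p : FibreProb A.momentum × G // p.1.base = 𝒢.r p.2} =>
      p.1.2) '' K) := hK.image (continuous_snd.comp continuous_subtype_val)
  have hlim' := hlim _ (A.isCompact_arrows hKG
    (hA.isCompact_preimage (hKG.image 𝒢.continuous_r)))
  rw [Metric.tendstoUniformlyOn_iff] at hlim' ⊢
  intro ε hε
  -- Halving `ε` restores strictness, since a pointwise bound gives only a weak inequality for the
  -- integral.
  filter_upwards [hlim' (ε / 2) (half_pos hε)] with i hi p hp
  have hsub : 1 - A.average (φ i) p =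
      ∫ z, (1 - A.sliceAt (φ i) p.1.2 z) ∂p.1.1.toMeasure := by
    rw [integral_sub (integrable_const 1) (A.integrable_sliceAt (hφ i) (hφc i) _ _)]
    simp [average]
  rw [dist_eq_norm, hsub]
  refine lt_of_le_of_lt (norm_integral_le_of_norm_le_const (C := ε / 2) ?_) (by simpa using hε)
  filter_upwards [p.1.1.ae_mem_fibre] with z hz
  rw [A.sliceAt_of_eq _ (hz.trans p.2), ← dist_eq_norm]
  exact (hi ⟨(z, p.1.2), hz.trans p.2⟩ ⟨p, hp, rfl⟩).le

variable [T2Space Y] [LocallyCompactSpace Y] [LocallyCompactSpace G]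

/-- The average vanishes at `(μ, γ)` unless `γ` lies in the compact projection of `tsupport φ` to
`G`. The arrows of `M ⋊ 𝒢` over that projection form a compact set by
`FibreProb.isCompact_preimage_base`. -/
theorem hasCompactSupport_average (hA : IsProperMap A.momentum) (h𝒢 : 𝒢.IsEtale)
    {φ : A.Arrows → ℂ} (hφ : HasCompactSupport φ) : HasCompactSupport (A.average φ) := by
  have := 𝒢.t2Space_unitSpace
  have hK : IsCompact ((fun p : A.Arrows => p.1.2) '' tsupport φ) :=
    hφ.isCompact.image (continuous_snd.comp continuous_subtype_val)
  refine ((A.onFibreProb h𝒢 hA).isCompact_arrows hK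
    (FibreProb.isCompact_preimage_base hA (hK.image 𝒢.continuous_r))).of_isClosed_subset
      (isClosed_tsupport _) (closure_minimal (fun p hp => ?_)
        (hK.isClosed.preimage (continuous_snd.comp continuous_subtype_val)))
  by_contra hpK
  refine hp ?_
  refine integral_eq_zero_of_ae (ae_of_all _ fun z => ?_)
  unfold sliceAt
  split_ifs with hz
  · by_contra h0
    exact hpK ⟨⟨(z, p.1.2), hz⟩, subset_tsupport _ h0, rfl⟩
  · rfl

/-- Pulling each integral against `μ · γᵢ` back to `μ` puts all matrix entries under one integral,
whose integrand is almost everywhere a quadratic form of `φ` at arrows with common range `z`. -/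
theorem isPositiveType_average (hA : IsProperMap A.momentum) (h𝒢 : 𝒢.IsEtale) {φ : A.Arrows → ℂ}
    (hφ : Continuous φ) (hφc : HasCompactSupport φ)
    (hpos : A.transformationGroupoid.IsPositiveType φ) :
    (A.onFibreProb h𝒢 hA).transformationGroupoid.IsPositiveType (A.average φ) := by
  intro n μ p hp c
  have hbase : ∀ i, μ.base = 𝒢.r (p i).1.2 := fun i => hp i ▸ (p i).2
  have hs : ∀ i j, 𝒢.s (𝒢.inv (p i).1.2) = 𝒢.r (p j).1.2 := fun i j =>
    (𝒢.s_inv _).trans ((hbase i).symm.trans (hbase j))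
  have hterm : ∀ i j, A.average φ ((A.onFibreProb h𝒢 hA).transformationGroupoid.mul
      ⟨((A.onFibreProb h𝒢 hA).transformationGroupoid.inv (p i), p j),
        ((A.onFibreProb h𝒢 hA).transformationGroupoid.s_inv (p i)).trans
          ((hp i).trans (hp j).symm)⟩) =
      ∫ z, A.sliceAt φ (𝒢.mul ⟨(𝒢.inv (p i).1.2, (p j).1.2), hs i j⟩)
        (A.translate (p i).1.2 z) ∂μ.toMeasure := fun i j => by
    refine (A.average_pushMeasure hφ (p i) _ _).trans ?_
    rw [show (p i).1.1 = μ from hp i]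
    rfl
  have hint : ∀ i j, Integrable (fun z => (starRingEnd ℂ) (c i) * c j *
      A.sliceAt φ (𝒢.mul ⟨(𝒢.inv (p i).1.2, (p j).1.2), hs i j⟩)
        (A.translate (p i).1.2 z)) μ.toMeasure := fun i j =>
    ((A.integrable_sliceAt hφ hφc _ (μ.toMeasure.map (A.translate (p i).1.2))).comp_measurable
      (A.measurable_translate _)).const_mul _
  simp_rw [hterm, ← integral_const_mul]
  rw [Finset.sum_congr rfl fun i _ => (integral_finsetSum Finset.univ fun j _ => hint i j).symm,
    ← integral_finsetSum Finset.univ fun i _ => integrable_finsetSum _ fun j _ => hint i j]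
  refine integral_nonneg_of_ae ?_
  filter_upwards [μ.ae_mem_fibre] with z hz
  have hz' : ∀ i, A.momentum z = 𝒢.r (p i).1.2 := fun i => hz.trans (hbase i)
  refine (hpos n z (fun i => ⟨(z, (p i).1.2), hz' i⟩) (fun _ => rfl) c).trans_eq ?_
  refine Finset.sum_congr rfl fun i _ => Finset.sum_congr rfl fun j _ => ?_
  rw [A.translate_of_eq (hz' i), A.sliceAt_of_eq]
  rfl

theorem average_unit_le_one (hA : IsProperMap A.momentum) (h𝒢 : 𝒢.IsEtale) {φ : A.Arrows → ℂ}
    (hφ : Continuous φ) (hφc : HasCompactSupport φ)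
    (hle : ∀ z, φ (A.transformationGroupoid.unit z) ≤ 1) (μ : FibreProb A.momentum) :
    A.average φ ((A.onFibreProb h𝒢 hA).transformationGroupoid.unit μ) ≤ 1 := by
  have h1 : ∫ _ : Y, (1 : ℂ) ∂μ.toMeasure = 1 := by simp
  refine (integral_mono_ae (A.integrable_sliceAt hφ hφc _ _) (integrable_const 1) ?_).trans_eq h1
  filter_upwards [μ.ae_mem_fibre] with z hz
  -- For `z` in the fibre over `μ.base`, the arrow `(z, unit μ.base)` is the unit of `Y ⋊ 𝒢` at `z`,
  -- so `hle` applies.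
  have hz' : A.momentum z = 𝒢.r (𝒢.unit μ.base) := hz.trans (𝒢.r_unit _).symm
  refine (A.sliceAt_of_eq φ hz').trans_le ((le_of_eq ?_).trans (hle z))
  exact congrArg φ (Subtype.ext (Prod.ext rfl (congrArg 𝒢.unit hz.symm)))

end TopGroupoid.RightAction

theorem mainTheorem6 {G : Type u} {X : Type v} {Y : Type w}
    [TopologicalSpace G] [T2Space G] [LocallyCompactSpace G]
    [TopologicalSpace X] [SigmaCompactSpace X]
    (𝒢 : TopGroupoid G X) (h𝒢 : 𝒢.IsEtale)
    [TopologicalSpace Y] [T2Space Y] [LocallyCompactSpace Y] [MeasurableSpace Y] [BorelSpace Y]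
    (A : 𝒢.RightAction Y) (hsurj : Function.Surjective A.momentum) (hopen : IsOpenMap A.momentum)
    (hproper : IsProperMap A.momentum) (hamen : A.transformationGroupoid.IsAmenable) :
    (A.onFibreProb h𝒢 hproper).transformationGroupoid.IsAmenable := by
  obtain ⟨I, hI, hdir, hne, φ, hφ, hlim⟩ := hamen
  refine ⟨I, hI, hdir, hne, fun i => A.average (φ i), fun i => ?_, fun K hK =>
    A.tendstoUniformlyOn_average hproper (fun i => (hφ i).1) (fun i => (hφ i).2.1) hlim hK⟩
  obtain ⟨hc, hs, hpos, hle⟩ := hφ i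
  exact ⟨A.continuous_average h𝒢 hproper hc, A.hasCompactSupport_average hproper h𝒢 hs,
    A.isPositiveType_average hproper h𝒢 hc hs hpos,
    A.average_unit_le_one hproper h𝒢 hc hs hle⟩
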